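/- Fix $K\in\mathbb N$ and constants $C_1,C_2,c>0$. For integers $m,n\ge 1$ and a parameter $\xi=(\beta,\boldsymbol\alpha,\mathbf F,\mathbf Z)\in\mathbb R\times\mathbb R^n\times\mathbb R^{m\times K}\times\mathbb R^{n\times K}$, where $\mathbf F$ has rows $\mathbf f_1,\dots,\mathbf f_m$ and $\mathbf Z$ has rows $\mathbf z_1,\dots,\mathbf z_n$, put $\theta_{ji}=\beta+\alpha_i+\mathbf f_j^\top\mathbf z_i$ and $p_{ji}=1/(1+e^{-\theta_{ji}})$. In the latent embedding hypergraph model with parameter $\xi$, the hyperlinks $E_1,\dots,E_m$ are independent random subsets of $[n]$ with $\mathbb P(E_j=e)=\prod_{i\in e}p_{ji}\prod_{i\in[n]\setminus e}(1-p_{ji})$ for every $e\subseteq[n]$. With $y_{ji}=\mathbf 1_{\{i\in E_j\}}$ and $\mathbf Y=(y_{ji})$, the log-likelihood is $\mathcal L(\xi\mid\mathbf Y)=\sum_{j=1}^m\sum_{i=1}^n\{y_{ji}\theta_{ji}-\log(1+e^{\theta_{ji}})\}$. For $C_\beta\in\mathbb R$ let $\mathcal F_1(C_\beta)$ be the set of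 all $\xi$ with $\mathbf J_m\mathbf F=\mathbf F$, where $\mathbf J_m=\mathbf I_m-m^{-1}\mathbf 1_m\mathbf 1_m^\top$, and with $\mathbf 1_n^\top\boldsymbol\alpha=0$, $|\alpha_i|,\|\mathbf z_i\|_2,\|\mathbf f_j\|_2\le C_1$ for all $i,j$, and $-C_\beta\le\beta\le C_2$. A constrained maximum likelihood estimate (CMLE) is any maximizer $(\hat\beta,\hat{\boldsymbol\alpha},\hat{\mathbf F},\hat{\mathbf Z})$ of $\mathcal L(\cdot\mid\mathbf Y)$ over $\mathcal F_1(C_\beta)$. There is a constant $C>0$, depending only on $K,C_1,C_2,c$, such that the following holds for all integers $m,n\ge1$ with $m\vee n\ge 2$, all $\varepsilon>0$, all $C_\beta\in\mathbb R$ and all true parameters $(\beta^*,\boldsymbol\alpha^*,\mathbf F^*,\mathbf Z^*)\in\mathcal F_1(C_\beta)$ with $$\exp(\beta^*)\ \ge\ c\,\frac{\log\big((m\vee n)/\varepsilon\big)}{m\wedge n}.$$ If $E_1,\dots,E_m$ follow the model with the true parameters, then with probability at least $1-\varepsilon$ every CMLE satisfies both $$\|\hat{\boldsymbol\alpha}-\boldsymbol\alpha^*\|_2\le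 C\,\frac{(m\vee n)^{1/2}\exp(\beta^*/2)\{\log((m\vee n)/\varepsilon)\}^{1/2}}{m^{1/2}\exp(-C_\beta)},\qquad |\hat\beta-\beta^*|\le C\,\frac{(m\vee n)^{1/2}\exp(\beta^*/2)\{\log((m\vee n)/\varepsilon)\}^{1/2}}{m^{1/2}n^{1/2}\exp(-C_\beta)}.$$ (For $\varepsilon\ge1$ the assertion is void, since $1-\varepsilon\le0$.) -/

import Mathlib

open MeasureTheory ProbabilityTheory

namespace LatentHypergraph

/-- The parameters of the latent embedding model with `n` vertices, `m` hyperlinks and a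
`K`-dimensional embedding space: the order-adjusting parameter `beta`, the vertex popularities
`alpha`, the hyperlink embeddings `f_j` (the rows of `F`) and the vertex embeddings `z_i` (the rows
of `Z`). -/
@[ext]
structure Params (K m n : ℕ) where
  beta : ℝ
  alpha : EuclideanSpace ℝ (Fin n)
  F : Matrix (Fin m) (Fin K) ℝ
  Z : Matrix (Fin n) (Fin K) ℝ

/-- `Θ = β 1_m 1_nᵀ + 1_m αᵀ + F Zᵀ`, with entries `θ_{ji} = β + α_i + f_jᵀ z_i`. -/
noncomputable def Params.theta {K m n : ℕ} (ξ : Params K m n) : Matrix (Fin m) (Fin n) ℝ :=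
  Matrix.of fun j i => ξ.beta + ξ.alpha i + (ξ.F * ξ.Z.transpose) j i

/-- `p_{ji} = σ(θ_{ji})` with the logistic function `σ(x) = 1 / (1 + exp(-x))`. -/
noncomputable def Params.prob {K m n : ℕ} (ξ : Params K m n) (j : Fin m) (i : Fin n) : ℝ :=
  Real.sigmoid (ξ.theta j i)

/-- The random hyperlinks `E_1, …, E_m` (random subsets of the vertex set) follow the latent
embedding model with parameter `ξ`: they are independent, and
`P(E_j = e) = ∏_{i ∈ e} p_{ji} ∏_{i ∉ e} (1 - p_{ji})` for every `e ⊆ [n]`. -/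
structure IsHypergraphModel {K m n : ℕ} {Ω : Type*} [MeasurableSpace Ω] (μ : Measure Ω)
    (ξ : Params K m n) (E : Fin m → Ω → Finset (Fin n)) : Prop where
  measurableSet_eq : ∀ j e, MeasurableSet {ω | E j ω = e}
  law : ∀ j e, μ {ω | E j ω = e} =
    ENNReal.ofReal ((∏ i ∈ e, ξ.prob j i) * ∏ i ∈ eᶜ, (1 - ξ.prob j i))
  indep : iIndepFun (m := fun _ => (⊤ : MeasurableSpace (Finset (Fin n)))) E μ

/-- The binary data matrix `Y` of a hypergraph: `y_{ji} = 1` if `i ∈ e_j` and `0` otherwise. -/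
def incidence {m n : ℕ} (e : Fin m → Finset (Fin n)) : Matrix (Fin m) (Fin n) ℝ :=
  Matrix.of fun j i => if i ∈ e j then 1 else 0

/-- The log-likelihood `∑_{j,i} (y_{ji} θ_{ji} - log (1 + exp θ_{ji}))`. -/
noncomputable def logLik {K m n : ℕ} (Y : Matrix (Fin m) (Fin n) ℝ) (ξ : Params K m n) : ℝ :=
  ∑ j, ∑ i, (Y j i * ξ.theta j i - Real.log (1 + Real.exp (ξ.theta j i)))

/-- The centering matrix `J_m = I_m - m⁻¹ 1_m 1_mᵀ`. -/
noncomputable def centering (m : ℕ) : Matrix (Fin m) (Fin m) ℝ :=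
  1 - (m : ℝ)⁻¹ • Matrix.of fun _ _ => 1

/-- The feasible region `F₁(Cβ)`, with bounds `C₁`, `C₂`. -/
def feasible (K m n : ℕ) (C₁ C₂ Cβ : ℝ) : Set (Params K m n) :=
  {ξ | centering m * ξ.F = ξ.F ∧ ∑ i, ξ.alpha i = 0 ∧
    (∀ i, |ξ.alpha i| ≤ C₁) ∧
    (∀ i, ‖WithLp.toLp 2 (ξ.Z i)‖ ≤ C₁) ∧
    (∀ j, ‖WithLp.toLp 2 (ξ.F j)‖ ≤ C₁) ∧
    -Cβ ≤ ξ.beta ∧ ξ.beta ≤ C₂}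

/-- `ξ` is a constrained maximum likelihood estimate for the data `Y`: it maximizes the
log-likelihood over the feasible region. -/
def IsCMLE {K m n : ℕ} (C₁ C₂ Cβ : ℝ) (Y : Matrix (Fin m) (Fin n) ℝ) (ξ : Params K m n) : Prop :=
  ξ ∈ feasible K m n C₁ C₂ Cβ ∧ IsMaxOn (logLik Y) (feasible K m n C₁ C₂ Cβ) ξ

/-- `(m ∨ n)^{1/2} exp(β/2) {log((m ∨ n)/ε)}^{1/2} / exp(-Cβ)`. -/
noncomputable def thetaRate (m n : ℕ) (β Cβ ε : ℝ) : ℝ :=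
  √(max m n : ℝ) * Real.exp (β / 2) * √(Real.log ((max m n : ℝ) / ε)) / Real.exp (-Cβ)

end LatentHypergraph

/-! Write Δ for the difference of the two matrices Θ and W = Y − P* for the noise, where P* is the
matrix of true probabilities. A CMLE has likelihood at least that of the truth, and the
log-partition function has curvature κ of order exp(−Cβ) on the feasible range. Hence (κ/2)‖Δ‖_F² ≤
⟨W, Δ⟩. Since Δ has rank at most 2K+1, trace duality gives ⟨W, Δ⟩ ≤ ‖W‖_op (2K+1)^{1/2} ‖Δ‖_F, so
‖Δ‖_F is at most a constant times ‖W‖_op exp(Cβ) (`sqrt_sum_sq_theta_sub_le`). The identifiability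
constraints make the β, α and FZᵀ parts of Δ orthogonal, so ‖Δ‖_F² dominates mn(β̂−β*)² + m‖α̂−α*‖²
(`sum_sq_theta_sub_ge`).

What remains is ‖W‖_op² ≲ (m∨n) exp(β*) log((m∨n)/ε) with probability 1 − ε
(`IsHypergraphModel.noise_concentration`). This is a moment method on the Hermitian dilation H of W.
Resampling one entry gives an exchangeable pair, hence an integration by parts for tr H^{2q}. A
trace mean value inequality and Young's inequality then bound E tr H^{2q} by moments of the row and
column sums of squared noise (`cubeE_trace_noiseSum_pow_le`). Those have exponential moments, and
Markov's inequality with q ≈ log((m∨n)/ε) finishes. The sparsity assumption keeps q below a constant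
multiple of (m∨n) exp(β*). -/

namespace LatentHypergraph

open Matrix

/-! ### Product Bernoulli measure, resampling and exponential moments. -/

section Cube

variable {ι : Type*} [Fintype ι]

/-- The mass function of the Bernoulli distribution with success probability `p`. -/
noncomputable def bernoulliWeight (p : ℝ) (b : Bool) : ℝ := if b then p else 1 - p

/-- The centred Bernoulli variable with success probability `p`. -/
noncomputable def bernoulliNoise (p : ℝ) (b : Bool) : ℝ := (if b then 1 else 0) - p

/-- The product mass function on the cube. -/
noncomputable def cubeWeight (p : ι → ℝ) (s : ι → Bool) : ℝ := ∏ k, bernoulliWeight (p k) (s k)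

lemma bernoulliWeight_nonneg {p : ℝ} (h0 : 0 ≤ p) (h1 : p ≤ 1) (b : Bool) :
    0 ≤ bernoulliWeight p b := by
  unfold bernoulliWeight; split_ifs <;> linarith

lemma cubeWeight_nonneg {p : ι → ℝ} (h0 : ∀ k, 0 ≤ p k) (h1 : ∀ k, p k ≤ 1) (s : ι → Bool) :
    0 ≤ cubeWeight p s :=
  Finset.prod_nonneg fun k _ => bernoulliWeight_nonneg (h0 k) (h1 k) _

variable [DecidableEq ι]

/-- The expectation under the product Bernoulli distribution on the cube. -/
noncomputable def cubeE (p : ι → ℝ) (g : (ι → Bool) → ℝ) : ℝ := ∑ s, cubeWeight p s * g s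

/-- The expectation of a function of a pair of points of the cube, the second of which
arises from the first by resampling the coordinate `k`. -/
noncomputable def resampleE (p : ι → ℝ) (k : ι) (G : (ι → Bool) → (ι → Bool) → ℝ) : ℝ :=
  ∑ s, ∑ b, cubeWeight p s * bernoulliWeight (p k) b * G s (Function.update s k b)

lemma bernoulliNoise_sq_le_one {p : ℝ} (h0 : 0 ≤ p) (h1 : p ≤ 1) (b : Bool) :
    bernoulliNoise p b ^ 2 ≤ 1 := by
  unfold bernoulliNoise; split_ifs <;> nlinarith

lemma cubeE_prod (p : ι → ℝ) (g : ι → Bool → ℝ) :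
    cubeE p (fun s => ∏ k, g k (s k)) = ∏ k, ∑ b, bernoulliWeight (p k) b * g k b := by
  rw [Finset.prod_univ_sum, Fintype.piFinset_univ]
  simp only [cubeE, cubeWeight, Finset.prod_mul_distrib]

lemma cubeE_mono {p : ι → ℝ} (h0 : ∀ k, 0 ≤ p k) (h1 : ∀ k, p k ≤ 1) {f g : (ι → Bool) → ℝ}
    (h : ∀ s, f s ≤ g s) : cubeE p f ≤ cubeE p g :=
  Finset.sum_le_sum fun s _ => mul_le_mul_of_nonneg_left (h s) (cubeWeight_nonneg h0 h1 s)

lemma cubeE_sum {κ : Type*} (t : Finset κ) (p : ι → ℝ) (f : κ → (ι → Bool) → ℝ) :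
    cubeE p (fun s => ∑ k ∈ t, f k s) = ∑ k ∈ t, cubeE p (f k) := by
  simp only [cubeE, Finset.mul_sum]
  exact Finset.sum_comm

lemma cubeE_const_mul (p : ι → ℝ) (a : ℝ) (f : (ι → Bool) → ℝ) :
    cubeE p (fun s => a * f s) = a * cubeE p f := by
  simp only [cubeE, Finset.mul_sum]
  exact Finset.sum_congr rfl fun s _ => by ring

lemma cubeE_add (p : ι → ℝ) (f g : (ι → Bool) → ℝ) :
    cubeE p (fun s => f s + g s) = cubeE p f + cubeE p g := by
  simp only [cubeE, mul_add, Finset.sum_add_distrib]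

/-- Detailed balance for resampling one coordinate; it makes the pair (s, s') exchangeable. -/
lemma cubeWeight_mul_update (p : ι → ℝ) (k : ι) (s : ι → Bool) (b : Bool) :
    cubeWeight p s * bernoulliWeight (p k) b =
      cubeWeight p (Function.update s k b) * bernoulliWeight (p k) (s k) := by
  unfold cubeWeight
  rw [Fintype.prod_eq_mul_prod_compl k, Fintype.prod_eq_mul_prod_compl k]
  have : ∏ i ∈ {k}ᶜ, bernoulliWeight (p i) (Function.update s k b i) =
      ∏ i ∈ {k}ᶜ, bernoulliWeight (p i) (s i) :=
    Finset.prod_congr rfl fun i hi => by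
      rw [Function.update_of_ne (by simpa using hi)]
  rw [this, Function.update_self]
  ring

lemma resampleE_swap (p : ι → ℝ) (k : ι) (G : (ι → Bool) → (ι → Bool) → ℝ) :
    resampleE p k G = resampleE p k (fun s s' => G s' s) := by
  unfold resampleE
  rw [← Fintype.sum_prod_type', ← Fintype.sum_prod_type']
  have hinv : Function.Involutive
      (fun x : (ι → Bool) × Bool => (Function.update x.1 k x.2, x.1 k)) := by
    rintro ⟨s, b⟩; simp
  refine Fintype.sum_equiv hinv.toPerm _ _ ?_
  rintro ⟨s, b⟩
  simp [cubeWeight_mul_update p k s b]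

lemma resampleE_mono {p : ι → ℝ} (h0 : ∀ k, 0 ≤ p k) (h1 : ∀ k, p k ≤ 1) (k : ι)
    {F G : (ι → Bool) → (ι → Bool) → ℝ}
    (h : ∀ s b, F s (Function.update s k b) ≤ G s (Function.update s k b)) :
    resampleE p k F ≤ resampleE p k G :=
  Finset.sum_le_sum fun s _ => Finset.sum_le_sum fun b _ =>
    mul_le_mul_of_nonneg_left (h s b)
      (mul_nonneg (cubeWeight_nonneg h0 h1 s) (bernoulliWeight_nonneg (h0 k) (h1 k) b))

lemma resampleE_add (p : ι → ℝ) (k : ι) (F G : (ι → Bool) → (ι → Bool) → ℝ) :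
    resampleE p k (fun s s' => F s s' + G s s') = resampleE p k F + resampleE p k G := by
  simp only [resampleE, mul_add, Finset.sum_add_distrib]

lemma resampleE_const_mul (p : ι → ℝ) (k : ι) (a : ℝ) (G : (ι → Bool) → (ι → Bool) → ℝ) :
    resampleE p k (fun s s' => a * G s s') = a * resampleE p k G := by
  simp only [resampleE, Finset.mul_sum]
  exact Finset.sum_congr rfl fun s _ => Finset.sum_congr rfl fun b _ => by ring

/-- The resampled noise is centred given s, so its contribution averages out. -/
lemma resampleE_noise_sub (p : ι → ℝ) (k : ι) (f : (ι → Bool) → ℝ) :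
    resampleE p k (fun s s' =>
      (bernoulliNoise (p k) (s k) - bernoulliNoise (p k) (s' k)) * f s) =
      cubeE p (fun s => bernoulliNoise (p k) (s k) * f s) := by
  refine Finset.sum_congr rfl fun s _ => ?_
  cases h : s k <;> simp [bernoulliWeight, bernoulliNoise, h] <;> ring

/-- Averaging (x − x')² over the fresh centred copy x' leaves x² plus the variance p(1 − p). -/
lemma resampleE_noise_sub_sq (p : ι → ℝ) (k : ι) (f : (ι → Bool) → ℝ) :
    resampleE p k (fun s s' =>
      (bernoulliNoise (p k) (s k) - bernoulliNoise (p k) (s' k)) ^ 2 * f s) =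
      cubeE p (fun s => (bernoulliNoise (p k) (s k) ^ 2 + p k * (1 - p k)) * f s) := by
  refine Finset.sum_congr rfl fun s _ => ?_
  cases h : s k <;> simp [bernoulliWeight, bernoulliNoise, h] <;> ring

/-- Integration by parts on the cube. -/
lemma cubeE_noise_mul (p : ι → ℝ) (k : ι) (f : (ι → Bool) → ℝ) :
    cubeE p (fun s => bernoulliNoise (p k) (s k) * f s) =
      1 / 2 * resampleE p k (fun s s' =>
        (bernoulliNoise (p k) (s k) - bernoulliNoise (p k) (s' k)) * (f s - f s')) := by
  have h1 := resampleE_noise_sub p k f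
  have h2 := h1
  rw [resampleE_swap] at h2
  have h3 : (fun s s' : ι → Bool =>
      (bernoulliNoise (p k) (s k) - bernoulliNoise (p k) (s' k)) * (f s - f s')) =
      fun s s' => (bernoulliNoise (p k) (s k) - bernoulliNoise (p k) (s' k)) * f s +
        (bernoulliNoise (p k) (s' k) - bernoulliNoise (p k) (s k)) * f s' := by
    funext s s'; ring
  rw [h3, resampleE_add, h1, h2]
  ring

/-- Moments of a weighted sum of squares of centred Bernoulli variables. -/
lemma cubeE_sum_sq_pow_le {p : ι → ℝ} (h0 : ∀ k, 0 ≤ p k) (h1 : ∀ k, p k ≤ 1) {δ : ι → ℝ}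
    (hδ0 : ∀ k, 0 ≤ δ k) (hδ1 : ∀ k, δ k ≤ 1) {S : ℝ} (hS : 0 < S)
    (hvar : ∑ k, p k * (1 - p k) * δ k ≤ S) {q : ℕ} (hq : (q : ℝ) ≤ S) :
    cubeE p (fun s => (∑ k, (bernoulliNoise (p k) (s k) ^ 2 + p k * (1 - p k)) * δ k) ^ q) ≤
      (S * Real.exp 3) ^ q := by
  -- With this t, (V/S)^q ≤ exp(tV). The assumption q ≤ S gives t ≤ 1, which is what allows the
  -- exponential to be linearised.
  set t : ℝ := q / S with ht
  have ht0 : 0 ≤ t := by positivity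
  have ht1 : t ≤ 1 := (div_le_one hS).2 hq
  have hexp : ∀ x : ℝ, 0 ≤ x → x ≤ 1 → Real.exp (t * x) ≤ 1 + 2 * t * x := by
    intro x hx0 hx1
    have hy0 : 0 ≤ t * x := by positivity
    have hy1 : t * x ≤ 1 := by nlinarith
    -- The chord of exp on [0, 1] gives exp y ≤ 1 + (e − 1)y ≤ 1 + 2y.
    have := convexOn_exp.2 (Set.mem_univ (0 : ℝ)) (Set.mem_univ (1 : ℝ)) (sub_nonneg.2 hy1) hy0
      (by ring)
    simp only [smul_eq_mul, mul_zero, mul_one, zero_add, Real.exp_zero] at this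
    nlinarith [Real.exp_one_lt_d9]
  have hsq : ∀ (k : ι) (b : Bool), 0 ≤ bernoulliNoise (p k) b ^ 2 * δ k ∧
      bernoulliNoise (p k) b ^ 2 * δ k ≤ 1 := fun k b =>
    ⟨mul_nonneg (sq_nonneg _) (hδ0 k), by
      have := bernoulliNoise_sq_le_one (h0 k) (h1 k) b
      nlinarith [hδ0 k, hδ1 k, sq_nonneg (bernoulliNoise (p k) b)]⟩
  have hσ : ∀ k, 0 ≤ p k * (1 - p k) * δ k := fun k =>
    mul_nonneg (mul_nonneg (h0 k) (sub_nonneg.2 (h1 k))) (hδ0 k)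
  have hV : ∀ s : ι → Bool,
      0 ≤ ∑ k, (bernoulliNoise (p k) (s k) ^ 2 + p k * (1 - p k)) * δ k := fun s =>
    Finset.sum_nonneg fun k _ => by nlinarith [hσ k, (hsq k (s k)).1]
  calc _ ≤ cubeE p (fun s => S ^ q * ∏ k, Real.exp (t * ((bernoulliNoise (p k) (s k) ^ 2 +
          p k * (1 - p k)) * δ k))) := by
        refine cubeE_mono h0 h1 fun s => ?_
        rw [← Real.exp_sum, ← Finset.mul_sum]
        set V := ∑ k, (bernoulliNoise (p k) (s k) ^ 2 + p k * (1 - p k)) * δ k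
        have : V / S ≤ Real.exp (V / S) := by linarith [Real.add_one_le_exp (V / S)]
        calc V ^ q = S ^ q * (V / S) ^ q := by
              rw [← mul_pow, mul_div_cancel₀ _ hS.ne']
          _ ≤ S ^ q * Real.exp (V / S) ^ q := by
              gcongr
              exact div_nonneg (hV s) hS.le
          _ = _ := by rw [← Real.exp_nat_mul, ht]; congr 2; ring
    _ = S ^ q * ∏ k, ∑ b, bernoulliWeight (p k) b * Real.exp (t * ((bernoulliNoise (p k) b ^ 2 +
          p k * (1 - p k)) * δ k)) := by
        rw [cubeE_const_mul]
        rw [cubeE_prod p (fun k b => Real.exp (t * ((bernoulliNoise (p k) b ^ 2 +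
          p k * (1 - p k)) * δ k)))]
    _ ≤ S ^ q * ∏ k, Real.exp (3 * t * (p k * (1 - p k) * δ k)) := by
        gcongr with k
        · exact fun k _ => Finset.sum_nonneg fun b _ =>
            mul_nonneg (bernoulliWeight_nonneg (h0 k) (h1 k) b) (Real.exp_nonneg _)
        · calc _ ≤ ∑ b, bernoulliWeight (p k) b * ((1 + 2 * t * (bernoulliNoise (p k) b ^ 2 * δ k))
                * Real.exp (t * (p k * (1 - p k) * δ k))) := by
                gcongr with b
                · exact bernoulliWeight_nonneg (h0 k) (h1 k) b
                · rw [add_mul, mul_add, Real.exp_add]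
                  gcongr
                  exact hexp _ (hsq k b).1 (hsq k b).2
            _ = (1 + 2 * t * (p k * (1 - p k) * δ k)) *
                Real.exp (t * (p k * (1 - p k) * δ k)) := by
                simp [bernoulliWeight, bernoulliNoise]; ring
            _ ≤ Real.exp (2 * t * (p k * (1 - p k) * δ k)) *
                Real.exp (t * (p k * (1 - p k) * δ k)) := by
                gcongr
                linarith [Real.add_one_le_exp (2 * t * (p k * (1 - p k) * δ k))]
            _ = _ := by rw [← Real.exp_add]; congr 1; ring
    _ ≤ S ^ q * Real.exp 3 ^ q := by
        gcongr
        rw [← Real.exp_sum, ← Finset.mul_sum, ← Real.exp_nat_mul]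
        refine Real.exp_le_exp.2 ?_
        calc 3 * t * ∑ k, p k * (1 - p k) * δ k ≤ 3 * t * S := by gcongr
          _ = q * 3 := by rw [ht]; field_simp
    _ = _ := (mul_pow _ _ _).symm

end Cube

/-! ### Trace inequalities through joint spectral weights. -/

section Trace

variable {d : Type*} [Fintype d] [DecidableEq d]

lemma exists_diagonalization {A : Matrix d d ℝ} (hA : A.IsHermitian) :
    ∃ (U : Matrix d d ℝ) (a : d → ℝ), Uᵀ * U = 1 ∧ U * Uᵀ = 1 ∧
      ∀ k : ℕ, A ^ k = U * diagonal (fun i => a i ^ k) * Uᵀ := by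
  refine ⟨hA.eigenvectorUnitary, hA.eigenvalues, ?_, ?_, fun k => ?_⟩
  · simpa [star_eq_conjTranspose] using Unitary.coe_star_mul_self hA.eigenvectorUnitary
  · simpa [star_eq_conjTranspose] using Unitary.coe_mul_star_self hA.eigenvectorUnitary
  · conv_lhs => rw [hA.spectral_theorem, ← map_pow, diagonal_pow]
    rw [Unitary.conjStarAlgAut_apply]
    simp [star_eq_conjTranspose]
    rfl

lemma exists_pow_apply_diag {A : Matrix d d ℝ} (hA : A.IsHermitian) (x : d) :
    ∃ (c a : d → ℝ), (∀ i, 0 ≤ c i) ∧ ∀ k : ℕ, (A ^ k) x x = ∑ i, c i * a i ^ k := by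
  obtain ⟨U, a, -, -, h⟩ := exists_diagonalization hA
  refine ⟨fun i => U x i ^ 2, a, fun i => sq_nonneg _, fun k => ?_⟩
  rw [h, mul_apply]
  refine Finset.sum_congr rfl fun i _ => ?_
  rw [mul_diagonal, transpose_apply]
  ring

/-- The weights are squared overlaps of the two eigenbases. Any inequality linear in the traces
tr(A^k B^l) thus reduces to its scalar version on pairs of eigenvalues, although A and B need not
commute. -/
lemma exists_trace_pow_mul_pow {A B : Matrix d d ℝ} (hA : A.IsHermitian) (hB : B.IsHermitian) :
    ∃ (c : d → d → ℝ) (a b : d → ℝ), (∀ i j, 0 ≤ c i j) ∧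
      ∀ k l : ℕ, trace (A ^ k * B ^ l) = ∑ i, ∑ j, c i j * (a i ^ k * b j ^ l) := by
  obtain ⟨U, a, -, -, hU⟩ := exists_diagonalization hA
  obtain ⟨V, b, -, -, hV⟩ := exists_diagonalization hB
  refine ⟨fun i j => (Uᵀ * V) i j ^ 2, a, b, fun i j => sq_nonneg _, fun k l => ?_⟩
  have : trace (A ^ k * B ^ l) = trace (diagonal (fun i => a i ^ k) * (Uᵀ * V) *
      (diagonal (fun i => b i ^ l) * (Uᵀ * V)ᵀ)) := by
    rw [hU, hV]
    simp only [transpose_mul, transpose_transpose, mul_assoc]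
    rw [trace_mul_comm U]
    simp only [mul_assoc]
  rw [this, trace]
  refine Finset.sum_congr rfl fun i _ => ?_
  rw [diag_apply, mul_apply]
  refine Finset.sum_congr rfl fun j _ => ?_
  rw [diagonal_mul, diagonal_mul, transpose_apply]
  ring

lemma abs_pow_mul_add_le {x y : ℝ} (k l : ℕ) (hx : 0 ≤ x) (hy : 0 ≤ y) :
    x ^ k * y ^ l + x ^ l * y ^ k ≤ x ^ (k + l) + y ^ (k + l) := by
  have : 0 ≤ (x ^ k - y ^ k) * (x ^ l - y ^ l) := by
    rcases le_total x y with h | h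
    · exact mul_nonneg_of_nonpos_of_nonpos (sub_nonpos.2 (pow_le_pow_left₀ hx h k))
        (sub_nonpos.2 (pow_le_pow_left₀ hx h l))
    · exact mul_nonneg (sub_nonneg.2 (pow_le_pow_left₀ hy h k))
        (sub_nonneg.2 (pow_le_pow_left₀ hy h l))
  rw [pow_add, pow_add]
  nlinarith

/-- A mean value inequality for odd powers. -/
lemma sub_mul_pow_sub_pow_le (x y : ℝ) (r : ℕ) :
    (x - y) * (x ^ (2 * r + 1) - y ^ (2 * r + 1)) ≤
      (2 * r + 1) / 2 * ((x - y) ^ 2 * (x ^ (2 * r) + y ^ (2 * r))) := by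
  have hgeom := (Commute.all x y).geom_sum₂_mul (2 * r + 1)
  have hS : 2 * ∑ i ∈ Finset.range (2 * r + 1), x ^ i * y ^ (2 * r + 1 - 1 - i) ≤
      (2 * r + 1) * (x ^ (2 * r) + y ^ (2 * r)) := by
    -- Each term of the geometric sum is paired with its mirror image, and `abs_pow_mul_add_le`
    -- bounds the pair.
    have hrefl := Finset.sum_range_reflect (fun i => x ^ i * y ^ (2 * r + 1 - 1 - i)) (2 * r + 1)
    rw [two_mul, ← hrefl, hrefl]
    nth_rewrite 1 [← hrefl]
    rw [← Finset.sum_add_distrib]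
    calc _ ≤ ∑ i ∈ Finset.range (2 * r + 1), (x ^ (2 * r) + y ^ (2 * r)) := by
          refine Finset.sum_le_sum fun i hi => ?_
          have hi' : i ≤ 2 * r := Nat.lt_succ_iff.1 (Finset.mem_range.1 hi)
          have e1 : 2 * r + 1 - 1 - i = 2 * r - i := by omega
          have e2 : 2 * r + 1 - 1 - (2 * r - i) = i := by omega
          rw [e1, e2]
          have h := abs_pow_mul_add_le (2 * r - i) i (abs_nonneg x) (abs_nonneg y)
          rw [Nat.sub_add_cancel hi', pow_mul |x|, pow_mul |y|, sq_abs, sq_abs, ← pow_mul,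
            ← pow_mul] at h
          refine le_trans (add_le_add ?_ ?_) h
          · rw [← abs_pow, ← abs_pow, ← abs_mul]; exact le_abs_self _
          · rw [← abs_pow, ← abs_pow, ← abs_mul]; exact le_abs_self _
      _ = _ := by simp; ring
  rw [← hgeom]
  nlinarith [sq_nonneg (x - y)]

/-- By cyclicity of the trace both sides are combinations of tr(A^k B^l), so
`sub_mul_pow_sub_pow_le` can be averaged over the spectral weights. -/
lemma trace_sub_mul_pow_sub_pow_le {A B : Matrix d d ℝ} (hA : A.IsHermitian) (hB : B.IsHermitian)
    (r : ℕ) :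
    trace ((A - B) * (A ^ (2 * r + 1) - B ^ (2 * r + 1))) ≤
      (2 * r + 1) / 2 *
        (trace ((A - B) ^ 2 * A ^ (2 * r)) + trace ((A - B) ^ 2 * B ^ (2 * r))) := by
  obtain ⟨c, a, b, hc, h⟩ := exists_trace_pow_mul_pow hA hB
  have h1 : trace ((A - B) * (A ^ (2 * r + 1) - B ^ (2 * r + 1))) =
      trace (A ^ (2 * r + 2) * B ^ 0) - trace (A ^ 1 * B ^ (2 * r + 1)) -
        trace (A ^ (2 * r + 1) * B ^ 1) + trace (A ^ 0 * B ^ (2 * r + 2)) := by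
    rw [sub_mul, mul_sub, mul_sub, trace_sub, trace_sub, trace_sub,
      trace_mul_comm B (A ^ (2 * r + 1))]
    simp only [pow_zero, mul_one, one_mul, pow_one, ← pow_succ']
    ring
  have h2 : trace ((A - B) ^ 2 * A ^ (2 * r)) =
      trace (A ^ (2 * r + 2) * B ^ 0) - 2 * trace (A ^ (2 * r + 1) * B ^ 1) +
        trace (A ^ (2 * r) * B ^ 2) := by
    have e : (A - B) ^ 2 * A ^ (2 * r) = A ^ (2 * r + 2) - A * B * A ^ (2 * r) -
        B * A ^ (2 * r + 1) + B ^ 2 * A ^ (2 * r) := by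
      rw [pow_add, pow_succ' A (2 * r), (Commute.refl A).pow_pow (2 * r) 2]
      noncomm_ring
    rw [e, trace_add, trace_sub, trace_sub, trace_mul_comm (A * B), ← mul_assoc, ← pow_succ,
      trace_mul_comm B, trace_mul_comm (B ^ 2)]
    simp only [pow_zero, mul_one, pow_one]
    ring
  have h3 : trace ((A - B) ^ 2 * B ^ (2 * r)) =
      trace (A ^ 2 * B ^ (2 * r)) - 2 * trace (A ^ 1 * B ^ (2 * r + 1)) +
        trace (A ^ 0 * B ^ (2 * r + 2)) := by
    have e : (A - B) ^ 2 * B ^ (2 * r) = A ^ 2 * B ^ (2 * r) - A * B ^ (2 * r + 1) -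
        B * A * B ^ (2 * r) + B ^ (2 * r + 2) := by
      rw [pow_succ' B (2 * r), add_comm (2 * r) 2, pow_add]
      noncomm_ring
    rw [e, trace_add, trace_sub, trace_sub, mul_assoc B A, trace_mul_comm B, mul_assoc A,
      ← pow_succ]
    simp only [pow_zero, one_mul, pow_one]
    ring
  rw [h1, h2, h3]
  simp only [h]
  simp only [Finset.mul_sum, ← Finset.sum_add_distrib, ← Finset.sum_sub_distrib]
  refine Finset.sum_le_sum fun i _ => Finset.sum_le_sum fun j _ => ?_
  have := mul_le_mul_of_nonneg_left (sub_mul_pow_sub_pow_le (a i) (b j) r) (hc i j)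
  calc _ = c i j * ((a i - b j) * (a i ^ (2 * r + 1) - b j ^ (2 * r + 1))) := by ring
    _ ≤ _ := this
    _ = _ := by ring

/-- Young's inequality for the diagonal entries of even powers. -/
lemma mul_pow_apply_le {A : Matrix d d ℝ} (hA : A.IsHermitian) (x : d) {v : ℝ} (hv : 0 ≤ v)
    (r : ℕ) :
    (r + 1) * (v * (A ^ (2 * r)) x x) ≤ r * (A ^ (2 * r + 2)) x x + v ^ (r + 1) := by
  obtain ⟨c, a, hc, h⟩ := exists_pow_apply_diag hA x
  have hone : ∑ i, c i = 1 := by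
    have := h 0
    simpa using this.symm
  -- In the inductive step the defect is exactly (r+1) u^r (u − v)².
  have hyoung : ∀ u : ℝ, 0 ≤ u → (r + 1) * (v * u ^ r) ≤ r * u ^ (r + 1) + v ^ (r + 1) := by
    intro u hu
    induction r with
    | zero => simp
    | succ r ih =>
      have h1 := mul_le_mul_of_nonneg_left ih hv
      have h2 : 0 ≤ (r + 1) * (u ^ r * (u - v) ^ 2) := by positivity
      push_cast
      calc ((r : ℝ) + 1 + 1) * (v * u ^ (r + 1)) = (r + 1) * u ^ (r + 2)
            + (v * ((r + 1) * (v * u ^ r)) - v * (r * u ^ (r + 1))) -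
            (r + 1) * (u ^ r * (u - v) ^ 2) := by ring
        _ ≤ (r + 1) * u ^ (r + 2) + v * v ^ (r + 1) := by linarith
        _ = _ := by ring
  have hsum : v ^ (r + 1) = ∑ i, c i * v ^ (r + 1) := by rw [← Finset.sum_mul, hone, one_mul]
  rw [h, h, hsum]
  simp only [Finset.mul_sum, ← Finset.sum_add_distrib]
  refine Finset.sum_le_sum fun i _ => ?_
  have := mul_le_mul_of_nonneg_left (hyoung (a i ^ 2) (sq_nonneg _)) (hc i)
  calc _ = c i * ((r + 1) * (v * (a i ^ 2) ^ r)) := by rw [← pow_mul]; ring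
    _ ≤ _ := this
    _ = _ := by rw [← pow_mul]; ring

end Trace

/-! ### Matrix moment bound by exchangeable pairs. -/

section Moment

variable {ι d : Type*} [Fintype ι] [DecidableEq ι] [Fintype d] [DecidableEq d]

/-- The matrix series `∑ k, (y_k - p_k) B_k` in centred Bernoulli variables. -/
noncomputable def noiseSum (p : ι → ℝ) (B : ι → Matrix d d ℝ) (s : ι → Bool) : Matrix d d ℝ :=
  ∑ k, bernoulliNoise (p k) (s k) • B k

omit [DecidableEq ι] [Fintype d] [DecidableEq d] in
lemma noiseSum_isHermitian (p : ι → ℝ) {B : ι → Matrix d d ℝ} (hB : ∀ k, (B k).IsHermitian)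
    (s : ι → Bool) : (noiseSum p B s).IsHermitian := by
  unfold noiseSum IsHermitian
  rw [conjTranspose_sum]
  exact Finset.sum_congr rfl fun k _ => by rw [conjTranspose_smul, (hB k).eq, star_trivial]

omit [Fintype d] [DecidableEq d] in
lemma noiseSum_sub_update (p : ι → ℝ) (B : ι → Matrix d d ℝ) (s : ι → Bool) (k : ι) (b : Bool) :
    noiseSum p B s - noiseSum p B (Function.update s k b) =
      (bernoulliNoise (p k) (s k) - bernoulliNoise (p k) (Function.update s k b k)) • B k := by
  unfold noiseSum
  rw [← Finset.sum_sub_distrib, Finset.sum_eq_single k, ← sub_smul]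
  · intro i _ hi
    rw [Function.update_of_ne hi, sub_self]
  · simp

/-- After integration by parts, H(s) − H(s') is a scalar multiple of B_k, so the trace mean value
inequality applies to the pair. Exchangeability merges its two symmetric terms, and averaging over
the fresh copy gives the factor noise² + p(1 − p). -/
lemma cubeE_noise_mul_trace_le {p : ι → ℝ} (h0 : ∀ k, 0 ≤ p k) (h1 : ∀ k, p k ≤ 1)
    {B : ι → Matrix d d ℝ} (hB : ∀ k, (B k).IsHermitian) (r : ℕ) (k : ι) :
    cubeE p (fun s => bernoulliNoise (p k) (s k) * trace (B k * noiseSum p B s ^ (2 * r + 1))) ≤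
      (2 * r + 1) / 2 * cubeE p (fun s => (bernoulliNoise (p k) (s k) ^ 2 + p k * (1 - p k)) *
        trace (B k * B k * noiseSum p B s ^ (2 * r))) := by
  rw [cubeE_noise_mul]
  set H := noiseSum p B
  set D : (ι → Bool) → (ι → Bool) → ℝ :=
    fun s s' => (bernoulliNoise (p k) (s k) - bernoulliNoise (p k) (s' k)) ^ 2 *
      trace (B k * B k * H s ^ (2 * r)) with hD
  calc _ ≤ 1 / 2 * resampleE p k (fun s s' => (2 * r + 1) / 2 * (D s s' + D s' s)) := by
        gcongr
        refine resampleE_mono h0 h1 k fun s b => ?_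
        set s' := Function.update s k b
        set x := bernoulliNoise (p k) (s k) - bernoulliNoise (p k) (s' k) with hx
        have hsub : H s - H s' = x • B k := noiseSum_sub_update p B s k b
        have h := trace_sub_mul_pow_sub_pow_le (noiseSum_isHermitian p hB s)
          (noiseSum_isHermitian p hB s') r
        change trace ((H s - H s') * (H s ^ (2 * r + 1) - H s' ^ (2 * r + 1))) ≤
          (2 * r + 1) / 2 * (trace ((H s - H s') ^ 2 * H s ^ (2 * r)) +
            trace ((H s - H s') ^ 2 * H s' ^ (2 * r))) at h
        rw [hsub, smul_mul_assoc, trace_smul, mul_sub, trace_sub, smul_pow, sq (B k),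
          smul_mul_assoc, smul_mul_assoc, trace_smul, trace_smul] at h
        simp only [smul_eq_mul] at h
        refine h.trans (le_of_eq ?_)
        simp only [hD, ← hx]
        rw [show bernoulliNoise (p k) (s' k) - bernoulliNoise (p k) (s k) = -x by rw [hx]; ring]
        ring
    _ = (2 * r + 1) / 2 * resampleE p k D := by
        rw [resampleE_const_mul, resampleE_add, ← resampleE_swap]
        ring
    _ = _ := by rw [hD, resampleE_noise_sub_sq]

/-- A matrix Khintchine-type moment inequality for a series in centred Bernoulli variables whose
coefficient matrices have diagonal squares. -/
theorem cubeE_trace_noiseSum_pow_le {p : ι → ℝ} (h0 : ∀ k, 0 ≤ p k) (h1 : ∀ k, p k ≤ 1)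
    {B : ι → Matrix d d ℝ} (hB : ∀ k, (B k).IsHermitian) {δ : ι → d → ℝ}
    (hδ : ∀ k x, 0 ≤ δ k x) (hsq : ∀ k, B k * B k = diagonal (δ k)) (r : ℕ) :
    cubeE p (fun s => trace (noiseSum p B s ^ (2 * r + 2))) ≤
      ∑ x, cubeE p (fun s => ((2 * r + 1) / 2 *
        ∑ k, (bernoulliNoise (p k) (s k) ^ 2 + p k * (1 - p k)) * δ k x) ^ (r + 1)) := by
  set H := noiseSum p B with hH
  set V : d → (ι → Bool) → ℝ := fun x s =>
    ∑ k, (bernoulliNoise (p k) (s k) ^ 2 + p k * (1 - p k)) * δ k x with hV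
  have hV0 : ∀ x s, 0 ≤ V x s := fun x s => Finset.sum_nonneg fun k _ =>
    mul_nonneg (add_nonneg (sq_nonneg _) (mul_nonneg (h0 k) (sub_nonneg.2 (h1 k)))) (hδ k x)
  have hfirst : cubeE p (fun s => trace (H s ^ (2 * r + 2))) ≤
      cubeE p (fun s => ∑ x, (2 * r + 1) / 2 * V x s * (H s ^ (2 * r)) x x) := by
    calc _ = cubeE p (fun s => ∑ k, bernoulliNoise (p k) (s k) *
            trace (B k * H s ^ (2 * r + 1))) := by
          congr 1
          funext s
          rw [pow_succ' (H s)]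
          nth_rewrite 1 [hH]
          rw [noiseSum, Finset.sum_mul, trace_sum]
          exact Finset.sum_congr rfl fun k _ => by rw [smul_mul_assoc, trace_smul, smul_eq_mul]
      _ ≤ ∑ k, (2 * r + 1) / 2 * cubeE p (fun s =>
            (bernoulliNoise (p k) (s k) ^ 2 + p k * (1 - p k)) *
              trace (B k * B k * H s ^ (2 * r))) := by
          rw [cubeE_sum]
          exact Finset.sum_le_sum fun k _ => cubeE_noise_mul_trace_le h0 h1 hB r k
      _ = _ := by
          simp only [← cubeE_const_mul]
          rw [← cubeE_sum]
          congr 1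
          funext s
          simp only [hV, Finset.mul_sum, Finset.sum_mul]
          rw [Finset.sum_comm]
          refine Finset.sum_congr rfl fun k _ => ?_
          rw [hsq, trace, Finset.mul_sum, Finset.mul_sum]
          refine Finset.sum_congr rfl fun x _ => ?_
          rw [diag_apply, diagonal_mul]
          ring
  -- Young's inequality is applied to each diagonal entry, before taking expectations, because V is
  -- random.
  have hsecond : (r + 1) * cubeE p (fun s => ∑ x, (2 * r + 1) / 2 * V x s * (H s ^ (2 * r)) x x) ≤
      r * cubeE p (fun s => trace (H s ^ (2 * r + 2))) +
        ∑ x, cubeE p (fun s => ((2 * r + 1) / 2 * V x s) ^ (r + 1)) := by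
    rw [← cubeE_const_mul, ← cubeE_const_mul, ← cubeE_sum, ← cubeE_add]
    refine cubeE_mono h0 h1 fun s => ?_
    rw [trace, Finset.mul_sum, Finset.mul_sum, ← Finset.sum_add_distrib]
    refine Finset.sum_le_sum fun x _ => ?_
    exact mul_pow_apply_le (noiseSum_isHermitian p hB s) x
      (mul_nonneg (by positivity) (hV0 x s)) r
  have hr : (0 : ℝ) ≤ r + 1 := by positivity
  -- With M the trace moment, (r+1)M ≤ rM + (moments of V); the term rM is absorbed on the left.
  nlinarith [mul_le_mul_of_nonneg_left hfirst hr]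

/-- The moment bound with explicit constants. -/
theorem cubeE_trace_noiseSum_pow_le_card {p : ι → ℝ} (h0 : ∀ k, 0 ≤ p k) (h1 : ∀ k, p k ≤ 1)
    {B : ι → Matrix d d ℝ} (hB : ∀ k, (B k).IsHermitian) {δ : ι → d → ℝ}
    (hδ0 : ∀ k x, 0 ≤ δ k x) (hδ1 : ∀ k x, δ k x ≤ 1)
    (hsq : ∀ k, B k * B k = diagonal (δ k)) {S : ℝ} (hS : 0 < S)
    (hvar : ∀ x, ∑ k, p k * (1 - p k) * δ k x ≤ S) (r : ℕ) (hr : (r : ℝ) + 1 ≤ S) :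
    cubeE p (fun s => trace (noiseSum p B s ^ (2 * r + 2))) ≤
      Fintype.card d * ((r + 1) * S * Real.exp 3) ^ (r + 1) := by
  refine (cubeE_trace_noiseSum_pow_le h0 h1 hB hδ0 hsq r).trans ?_
  rw [← nsmul_eq_mul, ← Finset.card_univ]
  refine Finset.sum_le_card_nsmul _ _ _ fun x _ => ?_
  simp only [mul_pow]
  rw [cubeE_const_mul]
  have := cubeE_sum_sq_pow_le h0 h1 (fun k => hδ0 k x) (fun k => hδ1 k x) hS (hvar x)
    (q := r + 1) (by push_cast; exact hr)
  rw [mul_pow] at this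
  refine (mul_le_mul_of_nonneg_left this (by positivity)).trans ?_
  rw [mul_assoc]
  gcongr
  linarith

end Moment

/-! ### Operator norm, Schatten norm and low-rank duality. -/

section LinearAlgebra

variable {d a b : Type*} [Fintype d] [DecidableEq d] [Fintype a] [Fintype b] [DecidableEq b]

/-- A Schatten norm bounds the operator norm. -/
lemma dotProduct_mulVec_le_of_trace_pow_le {A : Matrix d d ℝ} (hA : A.IsHermitian) {t : ℝ}
    (ht : 0 ≤ t) {q : ℕ} (hq : q ≠ 0) (h : trace (A ^ (2 * q)) ≤ t ^ q) (x : d → ℝ) :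
    (A *ᵥ x) ⬝ᵥ (A *ᵥ x) ≤ t * (x ⬝ᵥ x) := by
  obtain ⟨U, e, hU1, hU2, hU⟩ := exists_diagonalization hA
  have htr : trace (A ^ (2 * q)) = ∑ i, (e i ^ 2) ^ q := by
    rw [hU, mul_assoc, trace_mul_comm, mul_assoc, hU1, mul_one, trace_diagonal]
    exact Finset.sum_congr rfl fun i _ => pow_mul _ _ _
  have he : ∀ i, e i ^ 2 ≤ t := fun i => by
    refine le_of_pow_le_pow_left₀ hq ht ?_
    rw [htr] at h
    exact (Finset.single_le_sum (f := fun i => (e i ^ 2) ^ q)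
      (fun i _ => by positivity) (Finset.mem_univ i)).trans h
  have hquad : ∀ w : d → ℝ, x ⬝ᵥ ((U * diagonal w * Uᵀ) *ᵥ x) = ∑ i, w i * (Uᵀ *ᵥ x) i ^ 2 := by
    intro w
    rw [mul_assoc, ← mulVec_mulVec, dotProduct_mulVec, ← mulVec_transpose, ← mulVec_mulVec,
      dotProduct]
    refine Finset.sum_congr rfl fun i _ => ?_
    rw [mulVec_diagonal]
    ring
  have hleft : (A *ᵥ x) ⬝ᵥ (A *ᵥ x) = ∑ i, e i ^ 2 * (Uᵀ *ᵥ x) i ^ 2 := by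
    have hsymm : Aᵀ = A := by simpa [conjTranspose_eq_transpose_of_trivial] using hA.eq
    rw [← hquad, ← hU, sq, ← mulVec_mulVec, dotProduct_mulVec x A, ← mulVec_transpose, hsymm]
  have hright : x ⬝ᵥ x = ∑ i, (Uᵀ *ᵥ x) i ^ 2 := by
    have := hquad 1
    rw [show diagonal (1 : d → ℝ) = 1 from diagonal_one, mul_one, hU2, one_mulVec] at this
    simpa using this
  rw [hleft, hright, Finset.mul_sum]
  exact Finset.sum_le_sum fun i _ => mul_le_mul_of_nonneg_right (he i) (sq_nonneg _)

/-- Trace duality between the operator norm and low-rank matrices. -/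
lemma sum_mul_le_of_rank_le {W D : Matrix a b ℝ} {t : ℝ}
    (hW : ∀ x, (W *ᵥ x) ⬝ᵥ (W *ᵥ x) ≤ t * (x ⬝ᵥ x)) {r : ℕ} (hD : D.rank ≤ r) :
    ∑ j, ∑ i, W j i * D j i ≤ √t * √r * √(∑ j, ∑ i, D j i ^ 2) := by
  have hA : (Dᵀ * D).IsHermitian := by
    rw [← conjTranspose_eq_transpose_of_trivial]; exact isHermitian_conjTranspose_mul_self D
  obtain ⟨U, e, hU1, hU2, hU⟩ := exists_diagonalization hA
  -- In an orthonormal eigenbasis U of DᵀD the columns of DU are orthogonal with squared norms e_k,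
  -- and at most r of them are nonzero. Each column of WU has squared norm at most t. Cauchy–Schwarz
  -- is used within columns, then over the nonzero columns.
  set X := W * U with hX
  set Z := D * U with hZ
  have hZZ : Zᵀ * Z = diagonal e := by
    have h1 := hU 1
    simp only [pow_one] at h1
    calc Zᵀ * Z = Uᵀ * (Dᵀ * D) * U := by rw [hZ, transpose_mul]; simp only [Matrix.mul_assoc]
      _ = (Uᵀ * U) * diagonal e * (Uᵀ * U) := by rw [h1]; simp only [mul_assoc]
      _ = diagonal e := by rw [hU1, one_mul, mul_one]
  have he : ∀ k, e k = ∑ j, Z j k ^ 2 := fun k => by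
    have := congrFun (congrFun hZZ k) k
    rw [diagonal_apply_eq, mul_apply] at this
    rw [← this]
    exact Finset.sum_congr rfl fun j _ => by rw [transpose_apply, sq]
  have hWk : ∀ k, ∑ j, X j k ^ 2 ≤ t := fun k => by
    have h1 := hW (fun i => U i k)
    have h2 : (fun i => U i k) ⬝ᵥ (fun i => U i k) = 1 := by
      have := congrFun (congrFun hU1 k) k
      rwa [one_apply_eq, mul_apply] at this
    rw [h2, mul_one] at h1
    refine le_trans (le_of_eq (Finset.sum_congr rfl fun j _ => ?_)) h1
    rw [sq]; rfl
  have hinner : ∑ j, ∑ i, W j i * D j i = ∑ k, ∑ j, X j k * Z j k := by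
    have h1 : trace (W * Dᵀ) = trace (X * Zᵀ) := by
      rw [hX, hZ, transpose_mul, Matrix.mul_assoc, ← Matrix.mul_assoc U, hU2, Matrix.one_mul]
    rw [Finset.sum_comm (f := fun k j => X j k * Z j k)]
    simpa [trace, mul_apply] using h1
  have hfrob : ∑ j, ∑ i, D j i ^ 2 = ∑ k, e k := by
    have h1 : trace (D * Dᵀ) = trace (Z * Zᵀ) := by
      rw [hZ, transpose_mul, Matrix.mul_assoc, ← Matrix.mul_assoc U, hU2, Matrix.one_mul]
    simp only [he]
    rw [Finset.sum_comm (f := fun k j => Z j k ^ 2)]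
    simpa [trace, mul_apply, sq] using h1
  have hcard : ((Finset.univ.filter fun k => e k ≠ 0).card : ℝ) ≤ r := by
    have h1 := rank_diagonal e
    rw [← hZZ, rank_transpose_mul_self, Fintype.card_subtype] at h1
    rw [← h1]
    exact_mod_cast (rank_mul_le_left D U).trans hD
  have he0 : ∀ k, 0 ≤ e k := fun k => by rw [he]; positivity
  calc ∑ j, ∑ i, W j i * D j i = ∑ k, ∑ j, X j k * Z j k := hinner
    _ ≤ ∑ k, √t * √(e k) := by
        refine Finset.sum_le_sum fun k _ => ?_
        refine (Real.sum_mul_le_sqrt_mul_sqrt _ _ _).trans ?_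
        rw [← he]
        gcongr
        exact hWk k
    _ = √t * ∑ k ∈ Finset.univ.filter fun k => e k ≠ 0, 1 * √(e k) := by
        rw [Finset.mul_sum, Finset.sum_filter]
        refine Finset.sum_congr rfl fun k _ => ?_
        split_ifs with h
        · rw [one_mul]
        · rw [not_not.1 h]; simp
    _ ≤ √t * (√r * √(∑ k, e k)) := by
        gcongr
        refine (Real.sum_mul_le_sqrt_mul_sqrt _ _ _).trans ?_
        have h1 : ∑ k ∈ Finset.univ.filter (fun k => e k ≠ 0), √(e k) ^ 2 = ∑ k, e k := by
          rw [Finset.sum_filter]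
          refine Finset.sum_congr rfl fun k _ => ?_
          split_ifs with h
          · exact Real.sq_sqrt (he0 k)
          · exact (not_not.1 h).symm
        rw [h1]
        gcongr
        simpa using hcard
    _ = _ := by rw [hfrob]; ring

end LinearAlgebra

/-! ### Curvature of the log-partition function. -/

section Logistic

lemma hasDerivAt_log_one_add_exp (x : ℝ) :
    HasDerivAt (fun x => Real.log (1 + Real.exp x)) (Real.sigmoid x) x := by
  have h := ((Real.hasDerivAt_exp x).const_add 1).log (by positivity)
  convert h using 1
  rw [Real.sigmoid_def, Real.exp_neg]
  field_simp
  ring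

/-- Strong convexity of the log-partition function on an interval. -/
lemma sigmoid_mul_sub_add_le {lo hi κ x₀ x : ℝ}
    (hκ : ∀ u ∈ Set.Icc lo hi, κ ≤ Real.sigmoid u * (1 - Real.sigmoid u))
    (hx₀ : x₀ ∈ Set.Icc lo hi) (hx : x ∈ Set.Icc lo hi) :
    Real.sigmoid x₀ * (x - x₀) + κ / 2 * (x - x₀) ^ 2 ≤
      Real.log (1 + Real.exp x) - Real.log (1 + Real.exp x₀) := by
  -- Subtracting the quadratic leaves a convex function, which lies above its tangent at x₀.
  set g : ℝ → ℝ := fun u => Real.log (1 + Real.exp u) - κ / 2 * u ^ 2 with hg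
  have hd : ∀ u, HasDerivAt g (Real.sigmoid u - κ * u) u := fun u => by
    refine ((hasDerivAt_log_one_add_exp u).sub
      ((hasDerivAt_pow 2 u).const_mul (κ / 2))).congr_deriv ?_
    norm_num
    ring
  have hd2 : ∀ u, HasDerivAt (fun u => Real.sigmoid u - κ * u)
      (Real.sigmoid u * (1 - Real.sigmoid u) - κ) u := fun u => by
    exact ((Real.hasDerivAt_sigmoid u).sub ((hasDerivAt_id u).const_mul κ)).congr_deriv (by simp)
  have hconv : ConvexOn ℝ (Set.Icc lo hi) g := by
    refine MonotoneOn.convexOn_of_deriv (convex_Icc lo hi)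
      (fun u _ => (hd u).continuousAt.continuousWithinAt)
      (fun u _ => (hd u).differentiableAt.differentiableWithinAt) ?_
    have : deriv g = fun u => Real.sigmoid u - κ * u := funext fun u => (hd u).deriv
    rw [this]
    refine (monotoneOn_of_deriv_nonneg (convex_Icc lo hi)
      (fun u _ => (hd2 u).continuousAt.continuousWithinAt)
      (fun u _ => (hd2 u).differentiableAt.differentiableWithinAt) fun u hu => ?_).mono
        interior_subset
    rw [(hd2 u).deriv]
    exact sub_nonneg.2 (hκ u (interior_subset hu))
  have htangent : (Real.sigmoid x₀ - κ * x₀) * (x - x₀) ≤ g x - g x₀ := by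
    rcases lt_trichotomy x₀ x with h | h | h
    · have := hconv.le_slope_of_hasDerivAt hx₀ hx h (hd x₀)
      rw [slope_def_field, le_div_iff₀ (sub_pos.2 h)] at this
      exact this
    · rw [h]; simp
    · have := hconv.slope_le_of_hasDerivAt hx hx₀ h (hd x₀)
      rw [slope_def_field, div_le_iff₀ (sub_pos.2 h)] at this
      linarith
  simp only [hg] at htangent
  nlinarith

/-- This is the source of the factor exp(−Cβ): on the feasible range `hi` depends only on C₁ and C₂,
while `lo` is −Cβ up to a constant. -/
lemma exp_div_le_sigmoid_mul {lo hi u : ℝ} (hu : u ∈ Set.Icc lo hi) :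
    Real.exp lo / (1 + Real.exp hi) ^ 2 ≤ Real.sigmoid u * (1 - Real.sigmoid u) := by
  have h : Real.sigmoid u * (1 - Real.sigmoid u) = Real.exp u / (1 + Real.exp u) ^ 2 := by
    rw [Real.sigmoid_def, Real.exp_neg]
    have := Real.exp_pos u
    field_simp
    ring
  rw [h]
  gcongr
  · exact hu.1
  · exact hu.2

lemma sigmoid_le_exp (x : ℝ) : Real.sigmoid x ≤ Real.exp x := by
  rw [Real.sigmoid_def, ← neg_neg x, Real.exp_neg (-x), neg_neg]
  gcongr
  linarith

end Logistic

/-! ### Deterministic analysis of the estimator. -/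

section Parameters

variable {K m n : ℕ} {C₁ C₂ Cβ : ℝ}

lemma sum_F_eq_zero (hm : 1 ≤ m) {ξ : Params K m n} (h : ξ ∈ feasible K m n C₁ C₂ Cβ)
    (k : Fin K) : ∑ j, ξ.F j k = 0 := by
  have h1 : (centering m * ξ.F) ⟨0, hm⟩ k = ξ.F ⟨0, hm⟩ k := by rw [h.1]
  rw [centering, Matrix.sub_mul, Matrix.one_mul, Matrix.smul_mul, Matrix.sub_apply,
    Matrix.smul_apply, mul_apply] at h1
  simp only [of_apply, one_mul, smul_eq_mul, sub_eq_self, mul_eq_zero, inv_eq_zero,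
    Nat.cast_eq_zero] at h1
  exact h1.resolve_left (by omega)

lemma sum_mul_transpose_eq_zero (hm : 1 ≤ m) {ξ : Params K m n}
    (h : ξ ∈ feasible K m n C₁ C₂ Cβ) (i : Fin n) : ∑ j, (ξ.F * ξ.Zᵀ) j i = 0 := by
  simp only [mul_apply]
  rw [Finset.sum_comm]
  refine Finset.sum_eq_zero fun k _ => ?_
  rw [← Finset.sum_mul, sum_F_eq_zero hm h, zero_mul]

lemma abs_theta_sub_beta_le {ξ : Params K m n} (h : ξ ∈ feasible K m n C₁ C₂ Cβ)
    (j : Fin m) (i : Fin n) : |ξ.theta j i - ξ.beta| ≤ C₁ + C₁ ^ 2 := by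
  obtain ⟨-, -, hα, hZ, hF, -, -⟩ := h
  have h1 : |(ξ.F * ξ.Zᵀ) j i| ≤ C₁ ^ 2 := by
    have h2 := abs_real_inner_le_norm (WithLp.toLp 2 (ξ.Z i)) (WithLp.toLp 2 (ξ.F j))
    have h3 : inner ℝ (WithLp.toLp 2 (ξ.Z i)) (WithLp.toLp 2 (ξ.F j)) = (ξ.F * ξ.Zᵀ) j i := by
      rw [EuclideanSpace.inner_eq_star_dotProduct]
      simp [dotProduct, mul_apply]
    rw [h3] at h2
    refine h2.trans ?_
    rw [sq]
    exact mul_le_mul (hZ i) (hF j) (norm_nonneg _) ((norm_nonneg _).trans (hZ i))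
  have h4 : ξ.theta j i - ξ.beta = ξ.alpha i + (ξ.F * ξ.Zᵀ) j i := by
    simp only [Params.theta, of_apply]; ring
  rw [h4]
  exact (abs_add_le _ _).trans (add_le_add (hα i) h1)

lemma theta_mem_Icc {ξ : Params K m n} (h : ξ ∈ feasible K m n C₁ C₂ Cβ)
    (j : Fin m) (i : Fin n) :
    ξ.theta j i ∈ Set.Icc (-Cβ - (C₁ + C₁ ^ 2)) (C₂ + (C₁ + C₁ ^ 2)) := by
  have h1 := abs_le.1 (abs_theta_sub_beta_le h j i)
  obtain ⟨-, -, -, -, -, h2, h3⟩ := h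
  constructor <;> linarith

/-- Each product FZᵀ contributes K. All β and α terms together have the form 1_m wᵀ and contribute
only one. -/
lemma rank_theta_sub_le (ξ ξ₀ : Params K m n) : (ξ.theta - ξ₀.theta).rank ≤ 2 * K + 1 := by
  set X : Matrix (Fin m) (Fin K ⊕ Fin K ⊕ Unit) ℝ :=
    of fun j => Sum.elim (ξ.F j) (Sum.elim (ξ₀.F j) fun _ => 1) with hX
  set Y : Matrix (Fin K ⊕ Fin K ⊕ Unit) (Fin n) ℝ :=
    of (Sum.elim ξ.Zᵀ (Sum.elim (-ξ₀.Zᵀ)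
      fun _ i => (ξ.beta - ξ₀.beta) + (ξ.alpha i - ξ₀.alpha i))) with hY
  have h : ξ.theta - ξ₀.theta = X * Y := by
    ext j i
    have hY1 : ∀ k, Y (Sum.inl k) i = ξ.Z i k := fun _ => rfl
    have hY2 : ∀ k, Y (Sum.inr (Sum.inl k)) i = -ξ₀.Z i k := fun _ => rfl
    have hY3 : Y (Sum.inr (Sum.inr ())) i = (ξ.beta - ξ₀.beta) + (ξ.alpha i - ξ₀.alpha i) := rfl
    simp [Params.theta, mul_apply, hX, Fintype.sum_sum_type, hY1, hY2, hY3]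
    ring
  rw [h]
  refine (rank_mul_le_left X Y).trans ((rank_le_card_width X).trans (le_of_eq ?_))
  simp
  ring

/-- The three components of `Θ` are orthogonal under the identifiability constraints. -/
lemma sum_sq_theta_sub_ge (hm : 1 ≤ m) {ξ ξ₀ : Params K m n}
    (h : ξ ∈ feasible K m n C₁ C₂ Cβ) (h₀ : ξ₀ ∈ feasible K m n C₁ C₂ Cβ) :
    m * n * (ξ.beta - ξ₀.beta) ^ 2 + m * ‖ξ.alpha - ξ₀.alpha‖ ^ 2 ≤
      ∑ j, ∑ i, (ξ.theta - ξ₀.theta) j i ^ 2 := by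
  set b := ξ.beta - ξ₀.beta with hb
  set α : Fin n → ℝ := fun i => ξ.alpha i - ξ₀.alpha i with hα
  set G : Fin m → Fin n → ℝ := fun j i => (ξ.F * ξ.Zᵀ) j i - (ξ₀.F * ξ₀.Zᵀ) j i with hG
  have hΔ : ∀ j i, (ξ.theta - ξ₀.theta) j i = b + α i + G j i := fun j i => by
    rw [Matrix.sub_apply]; simp only [Params.theta, of_apply, hb, hα, hG]; ring
  have hG0 : ∀ i, ∑ j, G j i = 0 := fun i => by
    simp only [hG, Finset.sum_sub_distrib, sum_mul_transpose_eq_zero hm h,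
      sum_mul_transpose_eq_zero hm h₀, sub_zero]
  have hα0 : ∑ i, α i = 0 := by
    simp only [hα, Finset.sum_sub_distrib, h.2.1, h₀.2.1, sub_zero]
  have hnorm : ‖ξ.alpha - ξ₀.alpha‖ ^ 2 = ∑ i, α i ^ 2 := by
    rw [EuclideanSpace.real_norm_sq_eq]; rfl
  -- The cross terms vanish because α sums to zero and every column of FZᵀ sums to zero.
  calc m * n * b ^ 2 + m * ‖ξ.alpha - ξ₀.alpha‖ ^ 2 = m * ∑ i, (b + α i) ^ 2 := by
        have : ∑ i, (b + α i) ^ 2 = n * b ^ 2 + 2 * b * ∑ i, α i + ∑ i, α i ^ 2 := by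
          simp only [add_sq, Finset.sum_add_distrib, Finset.mul_sum]
          simp
        rw [this, hα0, hnorm]; ring
    _ ≤ ∑ i, ∑ j, (b + α i + G j i) ^ 2 := by
        rw [Finset.mul_sum]
        refine Finset.sum_le_sum fun i _ => ?_
        have : ∑ j, (b + α i + G j i) ^ 2 =
            m * (b + α i) ^ 2 + 2 * (b + α i) * ∑ j, G j i + ∑ j, G j i ^ 2 := by
          simp only [add_sq (b + α i), Finset.sum_add_distrib, Finset.mul_sum]
          simp
        rw [this, hG0]
        have : 0 ≤ ∑ j, G j i ^ 2 := Finset.sum_nonneg fun j _ => sq_nonneg _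
        linarith
    _ = _ := by simp only [hΔ]; exact Finset.sum_comm

/-- The basic inequality for the maximum likelihood estimate. -/
lemma sqrt_sum_sq_theta_sub_le {ξ ξ₀ : Params K m n} (h : ξ ∈ feasible K m n C₁ C₂ Cβ)
    (h₀ : ξ₀ ∈ feasible K m n C₁ C₂ Cβ) {Y : Matrix (Fin m) (Fin n) ℝ}
    (hL : logLik Y ξ₀ ≤ logLik Y ξ) {W : Matrix (Fin m) (Fin n) ℝ}
    (hWY : ∀ j i, W j i = Y j i - ξ₀.prob j i) {t : ℝ}
    (hW : ∀ x, (W *ᵥ x) ⬝ᵥ (W *ᵥ x) ≤ t * (x ⬝ᵥ x)) :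
    √(∑ j, ∑ i, (ξ.theta - ξ₀.theta) j i ^ 2) ≤
      2 * √(2 * K + 1) * (1 + Real.exp (C₂ + (C₁ + C₁ ^ 2))) ^ 2 * Real.exp (C₁ + C₁ ^ 2) *
        (√t / Real.exp (-Cβ)) := by
  set κ := Real.exp (-Cβ - (C₁ + C₁ ^ 2)) / (1 + Real.exp (C₂ + (C₁ + C₁ ^ 2))) ^ 2 with hκ
  have hκ0 : 0 < κ := by positivity
  set Δ := ξ.theta - ξ₀.theta with hΔ
  set R := √(∑ j, ∑ i, Δ j i ^ 2) with hR
  have hR0 : 0 ≤ R := Real.sqrt_nonneg _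
  have hRsq : R ^ 2 = ∑ j, ∑ i, Δ j i ^ 2 :=
    Real.sq_sqrt (Finset.sum_nonneg fun j _ => Finset.sum_nonneg fun i _ => sq_nonneg _)
  have hdual := sum_mul_le_of_rank_le hW (rank_theta_sub_le ξ ξ₀)
  rw [← hΔ, ← hR] at hdual
  push_cast at hdual
  have hbreg : κ / 2 * R ^ 2 ≤ ∑ j, ∑ i, W j i * Δ j i := by
    rw [← sub_nonneg] at hL
    have hterm : ∀ j i, (Y j i * ξ.theta j i - Real.log (1 + Real.exp (ξ.theta j i))) -
        (Y j i * ξ₀.theta j i - Real.log (1 + Real.exp (ξ₀.theta j i))) ≤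
        W j i * Δ j i - κ / 2 * Δ j i ^ 2 := fun j i => by
      have := sigmoid_mul_sub_add_le (fun u hu => exp_div_le_sigmoid_mul hu)
        (theta_mem_Icc h₀ j i) (theta_mem_Icc h j i)
      rw [← hκ] at this
      rw [hWY, hΔ, Matrix.sub_apply, Params.prob]
      nlinarith
    have := Finset.sum_le_sum fun j (_ : j ∈ Finset.univ) =>
      Finset.sum_le_sum fun i (_ : i ∈ Finset.univ) => hterm j i
    simp only [Finset.sum_sub_distrib, ← Finset.mul_sum] at this
    simp only [logLik, Finset.sum_sub_distrib] at hL
    rw [hRsq]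
    linarith
  have hfinal : R ≤ 2 * (√t * √(2 * K + 1)) / κ := by
    rw [le_div_iff₀ hκ0]
    -- The basic inequality is quadratic in R on the left and linear on the right; one factor R is
    -- cancelled when it is positive.
    rcases hR0.eq_or_lt with h0 | hpos
    · rw [← h0, zero_mul]; positivity
    · have : R * (R * κ) ≤ R * (2 * (√t * √(2 * K + 1))) := by nlinarith
      exact le_of_mul_le_mul_left this hpos
  refine hfinal.trans (le_of_eq ?_)
  rw [hκ, sub_eq_add_neg, Real.exp_add, Real.exp_neg (C₁ + C₁ ^ 2)]
  field_simp

end Parameters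

/-! ### Hermitian dilation and the operator norm tail. -/

section Dilation

variable {a b : Type*} [Fintype a] [Fintype b] [DecidableEq a] [DecidableEq b]

/-- The Hermitian dilation of a matrix unit. -/
def dilationUnit (k : a × b) : Matrix (a ⊕ b) (a ⊕ b) ℝ :=
  fromBlocks 0 (single k.1 k.2 1) (single k.2 k.1 1) 0

omit [Fintype a] [Fintype b] in
lemma dilationUnit_isHermitian (k : a × b) : (dilationUnit k).IsHermitian := by
  rw [IsHermitian, dilationUnit, fromBlocks_conjTranspose]
  simp

/-- Diagonal squares are what the moment inequality requires; summed against the variances they give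
the row and column sums. -/
lemma dilationUnit_mul_self (k : a × b) : dilationUnit k * dilationUnit k =
    diagonal (Sum.elim (Pi.single k.1 1) (Pi.single k.2 1) : a ⊕ b → ℝ) := by
  rw [dilationUnit, fromBlocks_multiply, ← fromBlocks_diagonal]
  simp [diagonal_single]

lemma noiseSum_dilationUnit (p : a × b → ℝ) (s : a × b → Bool) :
    noiseSum p dilationUnit s =
      fromBlocks 0 (of fun j i => bernoulliNoise (p (j, i)) (s (j, i)))
        (of fun j i => bernoulliNoise (p (j, i)) (s (j, i)))ᵀ 0 := by
  unfold noiseSum dilationUnit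
  ext x y
  rw [Matrix.sum_apply, Fintype.sum_prod_type]
  rcases x with x | x <;> rcases y with y | y
  · simp
  · rw [Finset.sum_eq_single x, Finset.sum_eq_single y] <;> simp +contextual [single_apply]
  · rw [Finset.sum_eq_single y, Finset.sum_eq_single x] <;> simp +contextual [single_apply]
  · simp

/-- The dilation sends (0, x) to (Wx, 0), so it inherits any operator bound for W. -/
lemma dotProduct_mulVec_le_of_trace_noiseSum_pow_le (p : a × b → ℝ) (s : a × b → Bool) {t : ℝ}
    (ht : 0 ≤ t) {q : ℕ} (hq : q ≠ 0)
    (h : trace (noiseSum p dilationUnit s ^ (2 * q)) ≤ t ^ q) (x : b → ℝ) :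
    ((of fun j i => bernoulliNoise (p (j, i)) (s (j, i))) *ᵥ x) ⬝ᵥ
      ((of fun j i => bernoulliNoise (p (j, i)) (s (j, i))) *ᵥ x) ≤ t * (x ⬝ᵥ x) := by
  have h1 := dotProduct_mulVec_le_of_trace_pow_le
    (noiseSum_isHermitian p dilationUnit_isHermitian s) ht hq h (Sum.elim 0 x)
  rw [noiseSum_dilationUnit, fromBlocks_mulVec] at h1
  simpa [dotProduct, Fintype.sum_sum_type] using h1

/-- Tail bound for the operator norm of a matrix of independent centred Bernoulli variables. -/
theorem cubeWeight_trace_noiseSum_le {p : a × b → ℝ} (h0 : ∀ k, 0 ≤ p k) (h1 : ∀ k, p k ≤ 1)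
    {S : ℝ} (hS : 0 < S) (hrow : ∀ j, ∑ i, p (j, i) ≤ S) (hcol : ∀ i, ∑ j, p (j, i) ≤ S)
    {q : ℕ} (hq : q ≠ 0) (hqS : (q : ℝ) ≤ S) :
    ∑ s with (q * S * Real.exp 5) ^ q < trace (noiseSum p dilationUnit s ^ (2 * q)),
      cubeWeight p s ≤ (Fintype.card a + Fintype.card b) * Real.exp (-(2 * q)) := by
  obtain ⟨r, rfl⟩ := Nat.exists_eq_succ_of_ne_zero hq
  have hvar : ∀ k, p k * (1 - p k) ≤ p k := fun k => by nlinarith [h0 k]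
  have hvar' : ∀ x, ∑ k : a × b, p k * (1 - p k) *
      (Sum.elim (Pi.single k.1 1) (Pi.single k.2 1) : a ⊕ b → ℝ) x ≤ S := by
    rintro (j | i)
    · refine le_trans ?_ (hrow j)
      rw [Fintype.sum_prod_type, Finset.sum_eq_single j]
      · exact Finset.sum_le_sum fun i _ => by simpa using hvar (j, i)
      · intro j' _ hj'
        simp [hj'.symm]
      · simp
    · refine le_trans ?_ (hcol i)
      rw [Fintype.sum_prod_type_right, Finset.sum_eq_single i]
      · exact Finset.sum_le_sum fun j _ => by simpa using hvar (j, i)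
      · intro i' _ hi'
        simp [hi'.symm]
      · simp
  have hδ : ∀ (k : a × b) (x : a ⊕ b),
      0 ≤ (Sum.elim (Pi.single k.1 1) (Pi.single k.2 1) : a ⊕ b → ℝ) x ∧
      (Sum.elim (Pi.single k.1 1) (Pi.single k.2 1) : a ⊕ b → ℝ) x ≤ 1 := by
    rintro k (j | i) <;> simp only [Sum.elim_inl, Sum.elim_inr, Pi.single_apply] <;>
      split_ifs <;> norm_num
  have hmom := cubeE_trace_noiseSum_pow_le_card h0 h1 dilationUnit_isHermitian
    (fun k x => (hδ k x).1) (fun k x => (hδ k x).2) dilationUnit_mul_self hS hvar' r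
    (by exact_mod_cast hqS)
  set f : (a × b → Bool) → ℝ := fun s => trace (noiseSum p dilationUnit s ^ (2 * (r + 1))) with hf
  have hf0 : ∀ s, 0 ≤ f s := fun s => by
    obtain ⟨U, e, hU1, -, hU⟩ :=
      exists_diagonalization (noiseSum_isHermitian p dilationUnit_isHermitian s)
    rw [hf]
    simp only
    rw [hU, mul_assoc, trace_mul_comm, mul_assoc, hU1, mul_one, trace_diagonal]
    exact Finset.sum_nonneg fun i _ => (even_two_mul _).pow_nonneg _
  -- The moment bound carries exp 3; raising it to exp 5 in the threshold leaves exp(−2q) after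
  -- Markov's inequality.
  set τ : ℝ := ((r + 1 : ℕ) * S * Real.exp 5) ^ (r + 1) with hτ
  have hτ0 : 0 < τ := by positivity
  have hmarkov : τ * ∑ s with τ < f s, cubeWeight p s ≤ cubeE p f := by
    rw [Finset.mul_sum, cubeE]
    calc _ ≤ ∑ s with τ < f s, cubeWeight p s * f s := by
          refine Finset.sum_le_sum fun s hs => ?_
          rw [mul_comm]
          exact mul_le_mul_of_nonneg_left (Finset.mem_filter.1 hs).2.le
            (cubeWeight_nonneg h0 h1 s)
      _ ≤ _ := Finset.sum_le_univ_sum_of_nonneg fun s =>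
          mul_nonneg (cubeWeight_nonneg h0 h1 s) (hf0 s)
  refine le_of_mul_le_mul_left (hmarkov.trans (hmom.trans (le_of_eq ?_))) hτ0
  have hexp : Real.exp 5 ^ (r + 1) * Real.exp (-(2 * (r + 1 : ℕ))) = Real.exp 3 ^ (r + 1) := by
    rw [← Real.exp_nat_mul, ← Real.exp_nat_mul, ← Real.exp_add]
    congr 1
    push_cast
    ring
  rw [hτ, mul_pow, ← hexp, mul_pow _ (Real.exp 5), Fintype.card_sum]
  push_cast
  ring

end Dilation

/-! ### From the hypergraph model to the cube. -/

section Model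

variable {K m n : ℕ} {Ω : Type*} [MeasurableSpace Ω] {μ : Measure Ω} {ξ : Params K m n}
  {E : Fin m → Ω → Finset (Fin n)}

/-- The success probabilities as a family indexed by pairs. -/
noncomputable def Params.probPair (ξ : Params K m n) (k : Fin m × Fin n) : ℝ := ξ.prob k.1 k.2

/-- The indicator family of the hyperlinks. -/
def indicatorPair (e : Fin m → Finset (Fin n)) (k : Fin m × Fin n) : Bool := decide (k.2 ∈ e k.1)

lemma prob_nonneg (ξ : Params K m n) (j : Fin m) (i : Fin n) : 0 ≤ ξ.prob j i :=
  Real.sigmoid_nonneg _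

lemma prob_le_one (ξ : Params K m n) (j : Fin m) (i : Fin n) : ξ.prob j i ≤ 1 :=
  Real.sigmoid_le_one _

lemma probPair_nonneg (ξ : Params K m n) (k : Fin m × Fin n) : 0 ≤ ξ.probPair k :=
  prob_nonneg ξ k.1 k.2

lemma probPair_le_one (ξ : Params K m n) (k : Fin m × Fin n) : ξ.probPair k ≤ 1 :=
  prob_le_one ξ k.1 k.2

/-- An upper bound suffices, since only a bad event has to be controlled. Monotonicity then avoids
any measurability question about the set on the left. -/
lemma IsHypergraphModel.measure_indicatorPair_eq_le (h : IsHypergraphModel μ ξ E)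
    (s : Fin m × Fin n → Bool) :
    μ {ω | indicatorPair (fun j => E j ω) = s} ≤ ENNReal.ofReal (cubeWeight ξ.probPair s) := by
  set e : Fin m → Finset (Fin n) := fun j => Finset.univ.filter fun i => s (j, i) = true with he
  have hsub : {ω | indicatorPair (fun j => E j ω) = s} ⊆
      ⋂ j ∈ (Finset.univ : Finset (Fin m)), E j ⁻¹' {e j} := by
    rintro ω rfl
    simp only [Finset.mem_univ, Set.iInter_true, Set.mem_iInter]
    intro j
    ext i
    simp [he, indicatorPair]
  have hindep := h.indep.measure_inter_preimage_eq_mul Finset.univ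
    (sets := fun j => {e j}) (fun j _ => trivial)
  refine (measure_mono hsub).trans (le_of_eq ?_)
  rw [hindep, cubeWeight, Fintype.prod_prod_type, ENNReal.ofReal_prod_of_nonneg]
  · refine Finset.prod_congr rfl fun j _ => ?_
    refine (h.law j (e j)).trans ?_
    congr 1
    rw [he]
    simp only [bernoulliWeight, Params.probPair]
    rw [Finset.prod_ite, Finset.compl_filter]
  · exact fun j _ => Finset.prod_nonneg fun i _ =>
      bernoulliWeight_nonneg (prob_nonneg ξ j i) (prob_le_one ξ j i) _

lemma IsHypergraphModel.measure_indicatorPair_le (h : IsHypergraphModel μ ξ E)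
    (P : (Fin m × Fin n → Bool) → Prop) [DecidablePred P] :
    μ {ω | P (indicatorPair fun j => E j ω)} ≤
      ENNReal.ofReal (∑ s with P s, cubeWeight ξ.probPair s) := by
  have hsub : {ω | P (indicatorPair fun j => E j ω)} ⊆
      ⋃ s ∈ Finset.univ.filter P, {ω | indicatorPair (fun j => E j ω) = s} := by
    intro ω hω
    simp only [Set.mem_iUnion]
    exact ⟨_, Finset.mem_filter.2 ⟨Finset.mem_univ _, hω⟩, rfl⟩
  refine (measure_mono hsub).trans ((measure_biUnion_finset_le _ _).trans ?_)
  rw [ENNReal.ofReal_sum_of_nonneg]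
  · exact Finset.sum_le_sum fun s _ => h.measure_indicatorPair_eq_le s
  · exact fun s _ => cubeWeight_nonneg (probPair_nonneg ξ) (probPair_le_one ξ) s

lemma prob_le_exp {C₁ C₂ Cβ : ℝ} (h : ξ ∈ feasible K m n C₁ C₂ Cβ) (j : Fin m) (i : Fin n) :
    ξ.prob j i ≤ Real.exp (C₁ + C₁ ^ 2) * Real.exp ξ.beta := by
  refine (sigmoid_le_exp _).trans ?_
  rw [← Real.exp_add]
  have := (abs_le.1 (abs_theta_sub_beta_le h j i)).2
  exact Real.exp_le_exp.2 (by linarith)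

/-- Concentration of the noise matrix of a hypergraph in operator norm. -/
theorem IsHypergraphModel.noise_concentration [IsProbabilityMeasure μ]
    (h : IsHypergraphModel μ ξ E) {C₁ C₂ Cβ c ε : ℝ} (hc : 0 < c)
    (hξ : ξ ∈ feasible K m n C₁ C₂ Cβ) (hm : 1 ≤ m) (hn : 1 ≤ n) (hmn : 2 ≤ max m n)
    (hε : 0 < ε) (hε1 : ε < 1)
    (hsparse : c * (Real.log ((max m n : ℝ) / ε) / (min m n : ℝ)) ≤ Real.exp ξ.beta) :
    ENNReal.ofReal (1 - ε) ≤ μ {ω | ∀ x : Fin n → ℝ,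
      ((of fun j i => incidence (fun j => E j ω) j i - ξ.prob j i) *ᵥ x) ⬝ᵥ
        ((of fun j i => incidence (fun j => E j ω) j i - ξ.prob j i) *ᵥ x) ≤
      3 * Real.exp 5 * (Real.exp (C₁ + C₁ ^ 2) + 3 / c) *
        ((max m n : ℝ) * Real.exp ξ.beta * Real.log ((max m n : ℝ) / ε)) * (x ⬝ᵥ x)} := by
  set N : ℝ := max (m : ℝ) n with hN
  set L : ℝ := Real.log (N / ε) with hL
  -- The first summand makes S dominate the row and column sums of probabilities. The second, with
  -- the sparsity assumption, makes S dominate q.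
  set A : ℝ := Real.exp (C₁ + C₁ ^ 2) + 3 / c with hA
  set S : ℝ := A * (N * Real.exp ξ.beta) with hS
  -- This choice gives exp(−2q) ≤ (ε/N)², which beats the dimension factor m + n ≤ 2N.
  set q : ℕ := ⌈L⌉₊ with hq
  have hN2 : 2 ≤ N := by rw [hN]; exact_mod_cast hmn
  have hA0 : 0 < A := by positivity
  have hS0 : 0 < S := by positivity
  -- It follows from N ≥ 2 and ε < 1, and it lets the rounding be absorbed as L + 1 ≤ 3L.
  have hL0 : 1 / 2 ≤ L := by
    have h1 : Real.log 2 ≤ L := by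
      refine Real.log_le_log (by norm_num) ?_
      rw [le_div_iff₀ hε]
      nlinarith
    linarith [Real.log_two_gt_d9]
  have hqL : L ≤ q := Nat.le_ceil L
  have hq3 : (q : ℝ) ≤ 3 * L := by
    have := (Nat.ceil_lt_add_one (by linarith : 0 ≤ L)).le
    linarith
  have hq0 : q ≠ 0 := by
    intro h0
    rw [h0] at hqL
    norm_num at hqL
    linarith
  have hmin : (0 : ℝ) < min (m : ℝ) n := lt_min (by exact_mod_cast hm) (by exact_mod_cast hn)
  have hLN : c * L ≤ N * Real.exp ξ.beta := by
    rw [← mul_div_assoc, div_le_iff₀ hmin] at hsparse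
    refine hsparse.trans ?_
    rw [mul_comm]
    gcongr
    exact min_le_max
  have hqS : (q : ℝ) ≤ S := by
    have h1 : 3 * L ≤ 3 / c * (N * Real.exp ξ.beta) := by
      rw [div_mul_eq_mul_div, le_div_iff₀ hc]
      linarith
    have h2 : 3 / c * (N * Real.exp ξ.beta) ≤ S := by
      rw [hS, hA]
      gcongr
      linarith [Real.exp_pos (C₁ + C₁ ^ 2)]
    linarith
  have hpS : ∀ l : ℕ, (l : ℝ) ≤ N → l * (Real.exp (C₁ + C₁ ^ 2) * Real.exp ξ.beta) ≤ S := by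
    intro l hl
    calc (l : ℝ) * (Real.exp (C₁ + C₁ ^ 2) * Real.exp ξ.beta)
        ≤ N * (A * Real.exp ξ.beta) := by
          gcongr
          rw [hA]
          have : 0 < 3 / c := by positivity
          linarith
      _ = S := by rw [hS]; ring
  have hrow : ∀ j, ∑ i, ξ.probPair (j, i) ≤ S := fun j => by
    refine le_trans ?_ (hpS n (le_max_right _ _))
    refine (Finset.sum_le_card_nsmul _ _ _ fun i _ => prob_le_exp hξ j i).trans (le_of_eq ?_)
    simp
  have hcol : ∀ i, ∑ j, ξ.probPair (j, i) ≤ S := fun i => by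
    refine le_trans ?_ (hpS m (le_max_left _ _))
    refine (Finset.sum_le_card_nsmul _ _ _ fun j _ => prob_le_exp hξ j i).trans (le_of_eq ?_)
    simp
  have htail := cubeWeight_trace_noiseSum_le (p := ξ.probPair)
    (probPair_nonneg ξ) (probPair_le_one ξ) hS0 hrow hcol hq0 hqS
  have hcard : ((Fintype.card (Fin m) : ℝ) + Fintype.card (Fin n)) * Real.exp (-(2 * q)) ≤ ε := by
    rw [Fintype.card_fin, Fintype.card_fin]
    have h1 : (m : ℝ) + n ≤ 2 * N := by
      linarith [le_max_left (m : ℝ) n, le_max_right (m : ℝ) n]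
    have h2 : Real.exp (-(2 * q)) ≤ (ε / N) ^ 2 := by
      have h3 : Real.exp (-L) = ε / N := by
        rw [Real.exp_neg, hL, Real.exp_log (by positivity), inv_div]
      rw [← h3, ← Real.exp_nat_mul]
      refine Real.exp_le_exp.2 ?_
      push_cast
      linarith
    calc ((m : ℝ) + n) * Real.exp (-(2 * q)) ≤ 2 * N * (ε / N) ^ 2 := by gcongr
      _ = 2 / N * ε * ε := by field_simp
      _ ≤ 1 * ε * 1 := by
          gcongr
          exact (div_le_one (by positivity)).2 hN2
      _ = ε := by ring
  set bad : (Fin m × Fin n → Bool) → Prop := fun s =>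
    (q * S * Real.exp 5) ^ q < trace (noiseSum ξ.probPair dilationUnit s ^ (2 * q)) with hbad
  classical
  have hμbad : μ {ω | bad (indicatorPair fun j => E j ω)} ≤ ENNReal.ofReal ε := by
    refine (h.measure_indicatorPair_le bad).trans (ENNReal.ofReal_le_ofReal ?_)
    refine le_trans (le_of_eq ?_) (htail.trans hcard)
    exact Finset.sum_congr (by ext; simp [hbad]) fun _ _ => rfl
  have hgood : {ω | bad (indicatorPair fun j => E j ω)}ᶜ ⊆ {ω | ∀ x : Fin n → ℝ,
      ((of fun j i => incidence (fun j => E j ω) j i - ξ.prob j i) *ᵥ x) ⬝ᵥ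
        ((of fun j i => incidence (fun j => E j ω) j i - ξ.prob j i) *ᵥ x) ≤
      3 * Real.exp 5 * A * (N * Real.exp ξ.beta * L) * (x ⬝ᵥ x)} := by
    intro ω hω x
    have h1 := dotProduct_mulVec_le_of_trace_noiseSum_pow_le ξ.probPair
      (indicatorPair fun j => E j ω) (by positivity) hq0 (not_lt.1 hω) x
    have h2 : (of fun j i => incidence (fun j => E j ω) j i - ξ.prob j i) =
        of fun j i => bernoulliNoise (ξ.probPair (j, i))
          (indicatorPair (fun j => E j ω) (j, i)) := by
      ext j i
      simp [incidence, bernoulliNoise, indicatorPair, Params.probPair]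
    rw [h2]
    refine h1.trans ?_
    have hx : 0 ≤ x ⬝ᵥ x := Finset.sum_nonneg fun i _ => mul_self_nonneg _
    refine mul_le_mul_of_nonneg_right ?_ hx
    calc q * S * Real.exp 5 ≤ 3 * L * S * Real.exp 5 := by gcongr
      _ = _ := by rw [hS]; ring
  refine le_trans ?_ (measure_mono hgood)
  -- Subadditivity is enough here and needs no measurability of the bad event.
  have htotal : (1 : ENNReal) ≤ μ {ω | bad (indicatorPair fun j => E j ω)} +
      μ {ω | bad (indicatorPair fun j => E j ω)}ᶜ := by
    rw [← measure_univ (μ := μ), ← Set.union_compl_self {ω | bad (indicatorPair fun j => E j ω)}]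
    exact measure_union_le _ _
  rw [ENNReal.ofReal_sub _ hε.le, ENNReal.ofReal_one, tsub_le_iff_left]
  exact htotal.trans (add_le_add hμbad le_rfl)

end Model

end LatentHypergraph

/-! ### Assembly of the error bounds. -/

theorem mainTheorem7 (K : ℕ) (C₁ C₂ c : ℝ) (hC₁ : 0 < C₁) (hC₂ : 0 < C₂) (hc : 0 < c) :
    ∃ C : ℝ, 0 < C ∧
      ∀ (m n : ℕ), 1 ≤ m → 1 ≤ n → 2 ≤ max m n →
      ∀ (Cβ ε : ℝ), 0 < ε →
      ∀ ξ₀ : LatentHypergraph.Params K m n,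
        ξ₀ ∈ LatentHypergraph.feasible K m n C₁ C₂ Cβ →
        c * (Real.log ((max m n : ℝ) / ε) / (min m n : ℝ)) ≤ Real.exp ξ₀.beta →
      ∀ (Ω : Type*) [MeasurableSpace Ω] (μ : Measure Ω) [IsProbabilityMeasure μ]
        (E : Fin m → Ω → Finset (Fin n)),
        LatentHypergraph.IsHypergraphModel μ ξ₀ E →
        ENNReal.ofReal (1 - ε) ≤
          μ {ω | ∀ ξ : LatentHypergraph.Params K m n,
            LatentHypergraph.IsCMLE C₁ C₂ Cβ
              (LatentHypergraph.incidence fun j => E j ω) ξ →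
            ‖ξ.alpha - ξ₀.alpha‖ ≤
                C * (LatentHypergraph.thetaRate m n ξ₀.beta Cβ ε / √(m : ℝ)) ∧
            |ξ.beta - ξ₀.beta| ≤
                C * (LatentHypergraph.thetaRate m n ξ₀.beta Cβ ε / √((m : ℝ) * n))} := by
  set M : ℝ := C₁ + C₁ ^ 2 with hM
  -- `C₃` is the constant of the deterministic bound, and `A` below is that of the noise bound; √A
  -- enters because the latter controls the squared operator norm.
  set C₃ : ℝ := 2 * √(2 * K + 1) * (1 + Real.exp (C₂ + M)) ^ 2 * Real.exp M with hC₃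
  set A : ℝ := 3 * Real.exp 5 * (Real.exp M + 3 / c) with hA
  have hC₃0 : 0 < C₃ := by positivity
  have hA0 : 0 < A := by positivity
  refine ⟨C₃ * √A, by positivity, ?_⟩
  intro m n hm hn hmn Cβ ε hε ξ₀ hξ₀ hsparse Ω _ μ _ E hE
  rcases le_or_gt 1 ε with hε1 | hε1
  · rw [ENNReal.ofReal_of_nonpos (by linarith)]
    exact zero_le
  refine (hE.noise_concentration hc hξ₀ hm hn hmn hε hε1 hsparse).trans (measure_mono ?_)
  -- From here on the argument is deterministic on the noise event, so it covers all CMLEs at once.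
  intro ω hω ξ hξ
  have hm0 : (0 : ℝ) < m := by exact_mod_cast hm
  have hn0 : (0 : ℝ) < n := by exact_mod_cast hn
  have hR := LatentHypergraph.sqrt_sum_sq_theta_sub_le hξ.1 hξ₀ (hξ.2 hξ₀) (fun _ _ => rfl) hω
  set R := √(∑ j, ∑ i, (ξ.theta - ξ₀.theta) j i ^ 2) with hRdef
  have hrate : √(A * ((max m n : ℝ) * Real.exp ξ₀.beta * Real.log ((max m n : ℝ) / ε))) /
      Real.exp (-Cβ) = √A * LatentHypergraph.thetaRate m n ξ₀.beta Cβ ε := by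
    have hs : √((max m n : ℝ) * Real.exp ξ₀.beta * Real.log ((max m n : ℝ) / ε)) =
        √(max m n : ℝ) * √(Real.exp ξ₀.beta) * √(Real.log ((max m n : ℝ) / ε)) := by
      rw [Real.sqrt_mul (by positivity), Real.sqrt_mul (by positivity)]
    rw [LatentHypergraph.thetaRate, Real.exp_half, Real.sqrt_mul hA0.le, hs]
    ring
  rw [hrate, ← mul_assoc] at hR
  have hR2 : R ^ 2 = ∑ j, ∑ i, (ξ.theta - ξ₀.theta) j i ^ 2 :=
    Real.sq_sqrt (Finset.sum_nonneg fun j _ => Finset.sum_nonneg fun i _ => sq_nonneg _)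
  have hdec := LatentHypergraph.sum_sq_theta_sub_ge hm hξ.1 hξ₀
  rw [← hR2] at hdec
  constructor
  -- In each of the two bounds the other nonnegative term of the orthogonal decomposition is
  -- dropped.
  · rw [← mul_div_assoc, le_div_iff₀ (by positivity)]
    refine le_trans (abs_le_of_sq_le_sq' ?_ (Real.sqrt_nonneg _)).2 hR
    rw [mul_pow, Real.sq_sqrt hm0.le]
    nlinarith [mul_nonneg (mul_pos hm0 hn0).le (sq_nonneg (ξ.beta - ξ₀.beta))]
  · rw [← mul_div_assoc, le_div_iff₀ (by positivity)]
    refine le_trans (abs_le_of_sq_le_sq' ?_ (Real.sqrt_nonneg _)).2 hR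
    rw [mul_pow, Real.sq_sqrt (by positivity), sq_abs]
    nlinarith [mul_nonneg hm0.le (sq_nonneg ‖ξ.alpha - ξ₀.alpha‖)]
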